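/- Let $\mathcal H_1,\mathcal H_2$ be complex separable Hilbert spaces (scalar products linear in the second factor) and let $A:\operatorname{dom}(A)\subseteq\mathcal H_1\to\mathcal H_2$ be a densely defined, closed, linear operator such that $A^*A\ge\varepsilon I_{\mathcal H_1}$ for some $\varepsilon>0$. Products of unbounded operators are taken on their natural (maximal) domains, and equalities of operators include equality of domains. Let $\mathcal H_A$ be the Hilbert space $\operatorname{dom}(A)$ with scalar product $(f,g)_A=(Af,Ag)_{\mathcal H_2}$, let $\mathcal K_A=\operatorname{ran}(A)$, a closed subspace of $\mathcal H_2$, and let $\widetilde A:\mathcal H_A\to\mathcal K_A$, $f\mapsto Af$, which is unitary. Let $J_A:\mathcal H_1\supseteq\operatorname{dom}(A)\to\mathcal H_A$, $f\mapsto f$. In the energy space $\mathcal H_A\oplus\mathcal H_1$ put $$G_{A,0}=\begin{pmatrix}0&J_A\\-A^*\widetilde A&0\end{pmatrix},\qquad \operatorname{dom}(G_{A,0})=\{f\in\mathcal H_A : \widetilde A f\in\operatorname{dom}(A^*)\}\oplus\operatorname{dom}(A),$$ and in $\mathcal H_1\oplus\mathcal H_2$ put $$Q_{A,0}=\begin{pmatrix}0&A^*\\A&0\end{pmatrix},\qquad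 \operatorname{dom}(Q_{A,0})=\operatorname{dom}(A)\oplus\operatorname{dom}(A^*).$$ Let $P_{\ker(Q_{A,0})}$ be the orthogonal projection onto $\ker(Q_{A,0})$ and let $U_{\widetilde A}:\mathcal H_A\oplus\mathcal H_1\to\mathcal H_1\oplus\mathcal K_A$ be the unitary operator $$U_{\widetilde A}=\begin{pmatrix}0&I_{\mathcal H_1}\\-i\widetilde A&0\end{pmatrix},\qquad U_{\widetilde A}(f,g)=(g,-iAf).$$ Then $\mathcal H_1\oplus\mathcal K_A=\ker(Q_{A,0})^{\perp}$, and $$Q_{A,0}\,[I-P_{\ker(Q_{A,0})}]=U_{\widetilde A}\; iG_{A,0}\; U_{\widetilde A}^{-1}$$ in the following sense: on $\mathcal H_1\oplus\mathcal K_A$ the two operators have the same domain and the same values; and, in all of $\mathcal H_1\oplus\mathcal H_2$, the left-hand side is the operator $V\,(U_{\widetilde A}\,iG_{A,0}\,U_{\widetilde A}^{-1})\,V^*$, where $V$ is the inclusion of $\mathcal H_1\oplus\mathcal K_A$ into $\mathcal H_1\oplus\mathcal H_2$ (that is, the right-hand side extended by zero to $\ker(Q_{A,0})$). In particular, $iG_{A,0}$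 is self-adjoint in $\mathcal H_A\oplus\mathcal H_1$, and $G_{A,0}$ generates a unitary group in $\mathcal H_A\oplus\mathcal H_1$, i.e. it is the infinitesimal generator of a strongly continuous one-parameter group of unitary operators $e^{G_{A,0}t}$, $t\in\mathbb R$. Moreover, $G_{A,0}$ is unitarily equivalent to $-G_{A,0}$. -/

import Mathlib

open scoped InnerProductSpace

noncomputable section

namespace AbstractWave

set_option linter.unusedSectionVars false

/-! ### Unbounded operators -/

section Operators

variable {E F G E' F' : Type*}
variable [AddCommGroup E] [Module ℂ E] [AddCommGroup F] [Module ℂ F] [AddCommGroup G] [Module ℂ G]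

/-- The product `S T` of two unbounded operators on its natural (maximal) domain
`{x ∈ dom T | T x ∈ dom S}`. -/
def opComp (S : F →ₗ.[ℂ] G) (T : E →ₗ.[ℂ] F) : E →ₗ.[ℂ] G where
  domain :=
    { carrier := {x | ∃ hx : x ∈ T.domain, T ⟨x, hx⟩ ∈ S.domain}
      zero_mem' := ⟨T.domain.zero_mem, by
        have h : T ⟨0, T.domain.zero_mem⟩ = 0 := T.map_zero
        rw [h]
        exact S.domain.zero_mem⟩
      add_mem' := by
        rintro x y ⟨hx, hx'⟩ ⟨hy, hy'⟩
        refine ⟨T.domain.add_mem hx hy, ?_⟩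
        have h : T ⟨x + y, T.domain.add_mem hx hy⟩ = T ⟨x, hx⟩ + T ⟨y, hy⟩ :=
          T.map_add ⟨x, hx⟩ ⟨y, hy⟩
        rw [h]
        exact S.domain.add_mem hx' hy'
      smul_mem' := by
        rintro c x ⟨hx, hx'⟩
        refine ⟨T.domain.smul_mem c hx, ?_⟩
        have h : T ⟨c • x, T.domain.smul_mem c hx⟩ = c • T ⟨x, hx⟩ := T.map_smul c ⟨x, hx⟩
        rw [h]
        exact S.domain.smul_mem c hx' }
  toFun :=
    { toFun := fun x => S ⟨T ⟨x, x.2.1⟩, x.2.2⟩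
      map_add' := fun x y => by
        rw [← S.map_add]
        congr 1
        exact Subtype.ext (T.map_add ⟨x, x.2.1⟩ ⟨y, y.2.1⟩)
      map_smul' := fun c x => by
        rw [RingHom.id_apply, ← S.map_smul]
        congr 1
        exact Subtype.ext (T.map_smul c ⟨x, x.2.1⟩) }

/-- An everywhere defined linear map, seen as an unbounded operator with domain the whole space. -/
def everywhere (T : E →ₗ[ℂ] F) : E →ₗ.[ℂ] F := T.toPMap ⊤

/-- The kernel `{x ∈ dom T | T x = 0}` of an unbounded operator, a subspace of the ambient space. -/
def opKer (T : E →ₗ.[ℂ] F) : Submodule ℂ E := (LinearMap.ker T.toFun).map T.domain.subtype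

theorem mem_opKer {T : E →ₗ.[ℂ] F} {x : E} : x ∈ opKer T ↔ (x, (0 : F)) ∈ T.graph := by
  simp [opKer, LinearPMap.mem_graph_iff]

end Operators

section Hilbert

variable {E F E' F' : Type*}
variable [NormedAddCommGroup E] [InnerProductSpace ℂ E]
variable [NormedAddCommGroup F] [InnerProductSpace ℂ F]
variable [NormedAddCommGroup E'] [InnerProductSpace ℂ E']
variable [NormedAddCommGroup F'] [InnerProductSpace ℂ F']

/-- The block operator `((0, B), (C, 0))` from `E ⊕ F` to `E' ⊕ F'` (Hilbert sums), that is,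
`(x, y) ↦ (B y, C x)` with domain `dom C ⊕ dom B`. -/
def offDiag (B : F →ₗ.[ℂ] E') (C : E →ₗ.[ℂ] F') :
    WithLp 2 (E × F) →ₗ.[ℂ] WithLp 2 (E' × F') where
  domain :=
    { carrier := {x | x.fst ∈ C.domain ∧ x.snd ∈ B.domain}
      zero_mem' := ⟨C.domain.zero_mem, B.domain.zero_mem⟩
      add_mem' := fun hx hy => ⟨C.domain.add_mem hx.1 hy.1, B.domain.add_mem hx.2 hy.2⟩
      smul_mem' := fun c _ hx => ⟨C.domain.smul_mem c hx.1, B.domain.smul_mem c hx.2⟩ }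
  toFun :=
    { toFun := fun x => WithLp.toLp 2 (B ⟨x.1.snd, x.2.2⟩, C ⟨x.1.fst, x.2.1⟩)
      map_add' := fun x y => by
        rw [← WithLp.toLp_add, Prod.mk_add_mk, ← B.map_add, ← C.map_add]
        rfl
      map_smul' := fun c x => by
        rw [RingHom.id_apply, ← WithLp.toLp_smul, Prod.smul_mk, ← B.map_smul, ← C.map_smul]
        rfl }

/-- The operators `S` in `E` and `T` in `F` are unitarily equivalent: `T = W S W⁻¹` (including
equality of domains) for some unitary `W : E → F`. -/
def UnitarilyEquivalent (S : E →ₗ.[ℂ] E) (T : F →ₗ.[ℂ] F) : Prop :=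
  ∃ W : E ≃ₗᵢ[ℂ] F,
    T = opComp (everywhere W.toLinearEquiv.toLinearMap)
      (opComp S (everywhere W.symm.toLinearEquiv.toLinearMap))

/-- `T` generates a unitary group: there is a strongly continuous one-parameter group `V t`,
`t ∈ ℝ`, of unitary operators whose infinitesimal generator is exactly `T`, i.e. `x ∈ dom T` and
`T x = y` if and only if `t ↦ V t x` is differentiable at `t = 0` with derivative `y`. -/
def GeneratesUnitaryGroup (T : E →ₗ.[ℂ] E) : Prop :=
  ∃ V : ℝ → (E ≃ₗᵢ[ℂ] E),
    V 0 = 1 ∧ (∀ s t, V (s + t) = V s * V t) ∧ (∀ x, Continuous fun t => V t x) ∧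
      ∀ x y, (x, y) ∈ T.graph ↔ HasDerivAt (fun t => V t x) y 0

end Hilbert

/-! ### The setting -/

variable {H₁ H₂ : Type*}
variable [NormedAddCommGroup H₁] [InnerProductSpace ℂ H₁] [CompleteSpace H₁]
variable [NormedAddCommGroup H₂] [InnerProductSpace ℂ H₂] [CompleteSpace H₂]

/-- `A` is a densely defined, closed operator from `H₁` to `H₂` such that `A* A ≥ ε I` for some
`ε > 0`, i.e. `(f, A* A f) ≥ ε ‖f‖²` for all `f ∈ dom (A* A)`. -/
structure WaveHypothesis (A : H₁ →ₗ.[ℂ] H₂) : Prop where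
  dense_domain : Dense (A.domain : Set H₁)
  isClosed : A.IsClosed
  coercive : ∃ ε : ℝ, 0 < ε ∧ ∀ f : (opComp A.adjoint A).domain,
    ε * ‖(f : H₁)‖ ^ 2 ≤ RCLike.re ⟪(f : H₁), opComp A.adjoint A f⟫_ℂ

variable {A : H₁ →ₗ.[ℂ] H₂}

theorem WaveHypothesis.injective (hA : WaveHypothesis A) : Function.Injective A.toFun := by
  rw [← LinearMap.ker_eq_bot, LinearMap.ker_eq_bot']
  intro f hf
  have hf' : A f = 0 := hf
  obtain ⟨ε, hε, h⟩ := hA.coercive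
  have hmem : (f : H₁) ∈ (opComp A.adjoint A).domain :=
    ⟨f.2, by
      change A f ∈ _
      rw [hf']
      exact Submodule.zero_mem _⟩
  have h0 : opComp A.adjoint A ⟨f, hmem⟩ = 0 := by
    change A.adjoint ⟨A f, _⟩ = 0
    have h1 : (⟨A f, hmem.2⟩ : A.adjoint.domain) = 0 := Subtype.ext hf'
    rw [h1]
    exact A.adjoint.map_zero
  have h2 := h ⟨f, hmem⟩
  rw [h0, inner_zero_right, map_zero] at h2
  have h3 : ‖(f : H₁)‖ ^ 2 ≤ 0 := by
    by_contra hc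
    push Not at hc
    nlinarith [mul_pos hε hc]
  have h4 : ‖(f : H₁)‖ = 0 := by
    have := sq_nonneg ‖(f : H₁)‖
    exact pow_eq_zero_iff (two_ne_zero) |>.1 (le_antisymm h3 this)
  exact Subtype.ext (norm_eq_zero.1 h4)

/-- The energy space `H_A`: the vector space `dom A` with the scalar product `(A f, A g)`. -/
def EnergySpace (_hA : WaveHypothesis A) : Type _ := A.domain

namespace EnergySpace

variable (hA : WaveHypothesis A)

instance : AddCommGroup (EnergySpace hA) := inferInstanceAs (AddCommGroup A.domain)

instance : Module ℂ (EnergySpace hA) := inferInstanceAs (Module ℂ A.domain)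

/-- The map `f ↦ A f` on `H_A`. -/
def toH₂ : EnergySpace hA →ₗ[ℂ] H₂ := A.toFun

instance : NormedAddCommGroup (EnergySpace hA) :=
  NormedAddCommGroup.induced _ _ (toH₂ hA) hA.injective

instance : InnerProductSpace ℂ (EnergySpace hA) where
  toNormedSpace := NormedSpace.induced ℂ _ _ (toH₂ hA)
  inner f g := ⟪toH₂ hA f, toH₂ hA g⟫_ℂ
  norm_sq_eq_re_inner f := norm_sq_eq_re_inner (toH₂ hA f)
  conj_inner_symm f g := inner_conj_symm (toH₂ hA f) (toH₂ hA g)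
  add_left f g h := by
    change ⟪toH₂ hA (f + g), toH₂ hA h⟫_ℂ = _
    rw [map_add, inner_add_left]
  smul_left f g c := by
    change ⟪toH₂ hA (c • f), toH₂ hA g⟫_ℂ = _
    rw [map_smul, inner_smul_left]

end EnergySpace

/-- The subspace `K_A = ran A` of `H₂`. -/
def rangeSpace (_hA : WaveHypothesis A) : Submodule ℂ H₂ := LinearMap.range A.toFun

/-- The unitary `Ã : H_A → K_A`, `f ↦ A f`. -/
def tildeA (hA : WaveHypothesis A) : EnergySpace hA ≃ₗᵢ[ℂ] rangeSpace hA where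
  toLinearEquiv := LinearEquiv.ofInjective A.toFun hA.injective
  norm_map' _ := rfl

/-! `H_A` is complete: by density of `{(f, A f) | f ∈ dom (A* A)}` in the graph of `A`,
`A* A ≥ ε I` gives `‖A f‖² ≥ ε ‖f‖²` on the whole of `dom A`. -/

theorem WaveHypothesis.lower_bound (hA : WaveHypothesis A) :
    ∃ ε : ℝ, 0 < ε ∧ ∀ f : A.domain, ε * ‖(f : H₁)‖ ^ 2 ≤ ‖A f‖ ^ 2 := by
  obtain ⟨ε, hε, h⟩ := hA.coercive
  refine ⟨ε, hε, ?_⟩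
  let L : WithLp 2 (H₁ × H₂) →ₗ[ℂ] H₁ × H₂ := (WithLp.linearEquiv 2 ℂ (H₁ × H₂)).toLinearMap
  have hLc : Continuous L := WithLp.prod_continuous_ofLp 2 H₁ H₂
  let M : Submodule ℂ (WithLp 2 (H₁ × H₂)) := A.graph.comap L
  have hM : IsClosed (M : Set (WithLp 2 (H₁ × H₂))) := hA.isClosed.preimage hLc
  have : CompleteSpace M := hM.completeSpace_coe
  have memM : ∀ f : A.domain, WithLp.toLp 2 ((f : H₁), A f) ∈ M := fun f => A.mem_graph f
  have exM : ∀ w ∈ M, ∃ f : A.domain, w = WithLp.toLp 2 ((f : H₁), A f) := by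
    intro w hw
    obtain ⟨f, h1, h2⟩ := A.mem_graph_iff.1 (show L w ∈ A.graph from hw)
    exact ⟨f, (WithLp.ofLp_injective 2 (Prod.ext h1 h2)).symm⟩
  -- surjectivity of `I + A* A`
  have surj : ∀ v : H₁, ∃ f : A.domain, ∃ hf : A f ∈ A.adjoint.domain,
      A.adjoint ⟨A f, hf⟩ = v - f := by
    intro v
    obtain ⟨f, hf⟩ := exM _ (M.starProjection_apply_mem (WithLp.toLp 2 (v, (0 : H₂))))
    have horth : ∀ g : A.domain, ⟪v - f, (g : H₁)⟫_ℂ = ⟪A f, A g⟫_ℂ := by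
      intro g
      have h1 := M.starProjection_inner_eq_zero (WithLp.toLp 2 (v, (0 : H₂))) _ (memM g)
      rw [hf] at h1
      simp only [WithLp.prod_inner_apply, WithLp.ofLp_sub, Prod.fst_sub, Prod.snd_sub,
        zero_sub, inner_neg_left] at h1
      exact add_neg_eq_zero.1 h1
    have hmem : A f ∈ A.adjoint.domain := A.mem_adjoint_domain_of_exists _ ⟨_, horth⟩
    exact ⟨f, hmem, LinearPMap.adjoint_apply_eq hA.dense_domain _ horth⟩
  let N : Submodule ℂ (WithLp 2 (H₁ × H₂)) := M ⊓ (A.adjoint.domain.comap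
    (LinearMap.snd ℂ H₁ H₂ ∘ₗ L))
  have hN : ∀ w ∈ N.topologicalClosure, ε * ‖w.fst‖ ^ 2 ≤ ‖w.snd‖ ^ 2 := by
    have hcl : IsClosed {w : WithLp 2 (H₁ × H₂) | ε * ‖w.fst‖ ^ 2 ≤ ‖w.snd‖ ^ 2} := by
      refine isClosed_le ?_ ?_
      · exact continuous_const.mul ((continuous_fst.comp hLc).norm.pow 2)
      · exact (continuous_snd.comp hLc).norm.pow 2
    intro w hw
    refine closure_minimal ?_ hcl hw
    rintro w ⟨hw1, hw2⟩
    obtain ⟨f, rfl⟩ := exM w hw1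
    have hf : A f ∈ A.adjoint.domain := hw2
    have h1 := h ⟨f, f.2, hf⟩
    have h2 : ⟪(f : H₁), opComp A.adjoint A ⟨f, f.2, hf⟩⟫_ℂ = ⟪A f, A f⟫_ℂ :=
      ((LinearPMap.adjoint_isFormalAdjoint hA.dense_domain).symm f ⟨A f, hf⟩).symm
    rw [h2, ← norm_sq_eq_re_inner (𝕜 := ℂ)] at h1
    exact h1
  intro f
  have key : WithLp.toLp 2 ((f : H₁), A f) ∈ N.topologicalClosure := by
    set w := WithLp.toLp 2 ((f : H₁), A f) with hw
    have hNM : N.topologicalClosure ≤ M :=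
      Submodule.topologicalClosure_minimal _ inf_le_left hM
    have hp := N.topologicalClosure.starProjection_apply_mem w
    obtain ⟨u, hu⟩ := exM _ (M.sub_mem (memM f) (hNM hp))
    obtain ⟨g, hg, hg'⟩ := surj u
    have hgN : WithLp.toLp 2 ((g : H₁), A g) ∈ N := ⟨memM g, hg⟩
    have h0 := N.topologicalClosure.starProjection_inner_eq_zero w _
      (N.le_topologicalClosure hgN)
    rw [← hw] at hu
    rw [hu] at h0
    simp only [WithLp.prod_inner_apply] at h0
    have h3 : ⟪A u, A g⟫_ℂ = ⟪(u : H₁), A.adjoint ⟨A g, hg⟩⟫_ℂ :=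
      (LinearPMap.adjoint_isFormalAdjoint hA.dense_domain).symm u ⟨A g, hg⟩
    rw [h3, hg', ← inner_add_right, add_sub_cancel, inner_self_eq_zero] at h0
    have h4 : u = 0 := Subtype.ext h0
    have h5 : w - N.topologicalClosure.starProjection w = 0 := by
      rw [hu, h4, A.map_zero]
      rfl
    rw [sub_eq_zero.1 h5]
    exact hp
  exact hN _ key

theorem rangeSpace_isClosed (hA : WaveHypothesis A) :
    IsClosed (rangeSpace hA : Set H₂) := by
  obtain ⟨ε, hε, h⟩ := hA.lower_bound
  have : CompleteSpace A.graph := hA.isClosed.completeSpace_coe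
  let s : A.graph →L[ℂ] H₂ := (ContinuousLinearMap.snd ℂ H₁ H₂).comp A.graph.subtypeL
  have hs : AntilipschitzWith (Real.toNNReal (max 1 (Real.sqrt ε⁻¹))) s := by
    refine AddMonoidHomClass.antilipschitz_of_bound s ?_
    rintro ⟨w, hw⟩
    obtain ⟨f, h1, h2⟩ := A.mem_graph_iff.1 hw
    rw [Real.coe_toNNReal _ (le_trans zero_le_one (le_max_left _ _))]
    change max ‖w.1‖ ‖w.2‖ ≤ _ * ‖w.2‖
    refine max_le ?_ ?_
    · have h3 : ‖w.1‖ ≤ Real.sqrt ε⁻¹ * ‖w.2‖ := by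
        rw [← h1, ← h2]
        refine le_of_sq_le_sq ?_ (by positivity)
        rw [mul_pow, Real.sq_sqrt (by positivity), inv_mul_eq_div, le_div_iff₀ hε, mul_comm]
        exact h f
      exact h3.trans (mul_le_mul_of_nonneg_right (le_max_right _ _) (norm_nonneg _))
    · exact le_mul_of_one_le_left (norm_nonneg _) (le_max_left _ _)
  have hr := hs.isClosed_range s.uniformContinuous
  convert hr using 1
  ext y
  constructor
  · rintro ⟨f, rfl⟩
    exact ⟨⟨_, A.mem_graph f⟩, rfl⟩
  · rintro ⟨⟨w, hw⟩, rfl⟩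
    obtain ⟨f, _, h2⟩ := A.mem_graph_iff.1 hw
    exact ⟨f, h2⟩

instance (hA : WaveHypothesis A) : CompleteSpace (rangeSpace hA) :=
  (rangeSpace_isClosed hA).completeSpace_coe

instance (hA : WaveHypothesis A) : CompleteSpace (EnergySpace hA) :=
  ((tildeA hA).isometry.isUniformInducing.completeSpace_congr (tildeA hA).surjective).2
    inferInstance

/-! ### The operators `G_{A,0}` and `Q_{A,0}` and the unitary `U_Ã` -/

/-- `J_A : H₁ ⊇ dom A → H_A`, `f ↦ f`, the inverse of the embedding of `H_A` into `H₁`. -/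
def opJ (hA : WaveHypothesis A) : H₁ →ₗ.[ℂ] EnergySpace hA where
  domain := A.domain
  toFun := (LinearMap.id : A.domain →ₗ[ℂ] A.domain)

/-- `G_{A,0} = ((0, J_A), (-A* Ã, 0))` in the energy space `H_A ⊕ H₁`, with domain
`dom (A* Ã) ⊕ dom A`. -/
def opG (hA : WaveHypothesis A) :
    WithLp 2 (EnergySpace hA × H₁) →ₗ.[ℂ] WithLp 2 (EnergySpace hA × H₁) :=
  offDiag (opJ hA) (-(opComp A.adjoint (everywhere (EnergySpace.toH₂ hA))))

/-- `Q_{A,0} = ((0, A*), (A, 0))` in `H₁ ⊕ H₂`, with domain `dom A ⊕ dom A*`. -/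
def opQ (A : H₁ →ₗ.[ℂ] H₂) : WithLp 2 (H₁ × H₂) →ₗ.[ℂ] WithLp 2 (H₁ × H₂) :=
  offDiag A.adjoint A

/-- The kernel of `Q_{A,0}`. -/
def kerQ (_hA : WaveHypothesis A) : Submodule ℂ (WithLp 2 (H₁ × H₂)) := opKer (opQ A)

theorem kerQ_isClosed (hA : WaveHypothesis A) :
    IsClosed (kerQ hA : Set (WithLp 2 (H₁ × H₂))) := by
  have hLc : Continuous (WithLp.ofLp : WithLp 2 (H₁ × H₂) → H₁ × H₂) :=
    WithLp.prod_continuous_ofLp 2 H₁ H₂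
  have h1 : IsClosed {x : WithLp 2 (H₁ × H₂) | (x.fst, (0 : H₂)) ∈ A.graph} :=
    hA.isClosed.preimage ((continuous_fst.comp hLc).prodMk continuous_const)
  have h2 : IsClosed {x : WithLp 2 (H₁ × H₂) | (x.snd, (0 : H₁)) ∈ A.adjoint.graph} :=
    (LinearPMap.adjoint_isClosed hA.dense_domain).preimage
      ((continuous_snd.comp hLc).prodMk continuous_const)
  convert h1.inter h2 using 1
  ext x
  rw [SetLike.mem_coe, kerQ, mem_opKer]
  constructor
  · intro hx
    obtain ⟨y, hy, hy'⟩ := (opQ A).mem_graph_iff.1 hx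
    simp only at hy hy'
    subst hy
    have e := congrArg WithLp.ofLp hy'
    exact ⟨A.mem_graph_iff.2 ⟨⟨_, y.2.1⟩, rfl, congrArg Prod.snd e⟩,
      A.adjoint.mem_graph_iff.2 ⟨⟨_, y.2.2⟩, rfl, congrArg Prod.fst e⟩⟩
  · rintro ⟨ha, hb⟩
    obtain ⟨a, ha1, ha2⟩ := A.mem_graph_iff.1 ha
    obtain ⟨b, hb1, hb2⟩ := A.adjoint.mem_graph_iff.1 hb
    simp only at ha1 ha2 hb1 hb2
    refine (opQ A).mem_graph_iff.2 ⟨⟨x, ha1 ▸ a.2, hb1 ▸ b.2⟩, rfl, ?_⟩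
    have ea : (⟨x.fst, ha1 ▸ a.2⟩ : A.domain) = a := Subtype.ext ha1.symm
    have eb : (⟨x.snd, hb1 ▸ b.2⟩ : A.adjoint.domain) = b := Subtype.ext hb1.symm
    change WithLp.toLp 2 (A.adjoint ⟨x.snd, _⟩, A ⟨x.fst, _⟩) = 0
    rw [ea, eb, ha2, hb2]
    rfl

instance (hA : WaveHypothesis A) : CompleteSpace (kerQ hA) :=
  (kerQ_isClosed hA).completeSpace_coe

/-- The operator `Q_{A,0} [I - P_{ker Q_{A,0}}]` in `H₁ ⊕ H₂`, on its natural domain. -/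
def opQred (hA : WaveHypothesis A) : WithLp 2 (H₁ × H₂) →ₗ.[ℂ] WithLp 2 (H₁ × H₂) :=
  opComp (opQ A)
    (everywhere (ContinuousLinearMap.id ℂ _ - (kerQ hA).starProjection).toLinearMap)

/-- The unitary `U_Ã = ((0, I), (-i Ã, 0))` from `H_A ⊕ H₁` onto `H₁ ⊕ K_A`, that is,
`(f, g) ↦ (g, -i A f)`, with inverse `(g, h) ↦ (i Ã⁻¹ h, g)`. -/
def unitaryU (hA : WaveHypothesis A) :
    WithLp 2 (EnergySpace hA × H₁) ≃ₗᵢ[ℂ] WithLp 2 (H₁ × rangeSpace hA) where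
  toFun x := WithLp.toLp 2 (x.snd, -Complex.I • tildeA hA x.fst)
  invFun y := WithLp.toLp 2 (Complex.I • (tildeA hA).symm y.snd, y.fst)
  map_add' x y := by
    refine WithLp.ofLp_injective 2 (Prod.ext rfl ?_)
    change -Complex.I • tildeA hA (x.fst + y.fst) =
      -Complex.I • tildeA hA x.fst + -Complex.I • tildeA hA y.fst
    rw [map_add, smul_add]
  map_smul' c x := by
    refine WithLp.ofLp_injective 2 (Prod.ext rfl ?_)
    change -Complex.I • tildeA hA (c • x.fst) = c • -Complex.I • tildeA hA x.fst
    rw [map_smul, smul_comm c]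
  left_inv x := by
    refine WithLp.ofLp_injective 2 (Prod.ext ?_ rfl)
    change Complex.I • (tildeA hA).symm (-Complex.I • tildeA hA x.fst) = x.fst
    rw [map_smul, smul_smul, LinearIsometryEquiv.symm_apply_apply]
    simp
  right_inv y := by
    refine WithLp.ofLp_injective 2 (Prod.ext rfl ?_)
    change -Complex.I • tildeA hA (Complex.I • (tildeA hA).symm y.snd) = y.snd
    rw [map_smul, smul_smul, LinearIsometryEquiv.apply_symm_apply]
    simp
  norm_map' x := by
    rw [WithLp.prod_norm_eq_of_L2, WithLp.prod_norm_eq_of_L2]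
    change Real.sqrt (‖x.snd‖ ^ 2 + ‖-Complex.I • tildeA hA x.fst‖ ^ 2) = _
    rw [norm_smul, norm_neg, Complex.norm_I, one_mul, LinearIsometryEquiv.norm_map, add_comm]

/-- The operator `U_Ã (i G_{A,0}) U_Ã⁻¹` in `H₁ ⊕ K_A`. -/
def conjG (hA : WaveHypothesis A) :
    WithLp 2 (H₁ × rangeSpace hA) →ₗ.[ℂ] WithLp 2 (H₁ × rangeSpace hA) :=
  opComp (everywhere (unitaryU hA).toLinearEquiv.toLinearMap)
    (opComp (Complex.I • opG hA) (everywhere (unitaryU hA).symm.toLinearEquiv.toLinearMap))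

/-- The inclusion of `H₁ ⊕ K_A` into `H₁ ⊕ H₂`. -/
def inclusion (hA : WaveHypothesis A) :
    WithLp 2 (H₁ × rangeSpace hA) →ₗᵢ[ℂ] WithLp 2 (H₁ × H₂) where
  toFun y := WithLp.toLp 2 (y.fst, (y.snd : H₂))
  map_add' _ _ := rfl
  map_smul' _ _ := rfl
  norm_map' y := by
    rw [WithLp.prod_norm_eq_of_L2, WithLp.prod_norm_eq_of_L2]
    rfl

end AbstractWave

end

noncomputable section

namespace AbstractWave

/-! ### The unitary group `exp (-i t R⁻¹)` of an injective bounded self-adjoint operator `R` -/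

/-! Everything about `G = opG hA` comes from its inverse. Coercivity makes the embedding `J : H_A →
H₁` bounded (`energyEmbedding`), and testing the definition of `A*` against `g ∈ dom A` shows that
`A* Ã` is the inverse of `J*` (`mem_graph_adjoint_toH₂_iff`). Hence `iG` is the inverse of a
bounded, injective, self-adjoint `R` (`mem_graph_I_smul_opG_iff`), and inverses of such operators
are self-adjoint (`isSelfAdjoint_of_inverse`).

The group `exp (-itR⁻¹)` needs no unbounded functional calculus. The function `exp (-it/x)` is
singular at `0`, but `x exp (-it/x)` is continuous, so `S t = R exp (-itR⁻¹)` is defined by the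
continuous functional calculus. Since `‖S t x‖ = ‖R x‖`, the map `R x ↦ S t x` extends isometrically
from the dense range of `R`. The generator is read off from scalar estimates on `x exp (-it/x)`
(`generatesUnitaryGroup_of_inverse`).

For the comparison with `Q`, let `V` be the inclusion of `H₁ ⊕ K_A`. Injectivity of `A` gives `ker Q
= 0 ⊕ (ran A)ᗮ = (ran V)ᗮ`, so `I - P = V V*`; the conjugated operator is the part of `Q` in `ran V`
(`mem_graph_conjG`); and `ran Q ⊆ ran V`. -/

/-- The function `x ↦ x exp (-i t / x)` of a real variable `x`, composed with the real part. -/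
def phase (t : ℝ) (z : ℂ) : ℂ := z.re * Complex.exp (Complex.I * ((-t / z.re : ℝ) : ℂ))

theorem norm_phase (t : ℝ) (z : ℂ) : ‖phase t z‖ = |z.re| := by
  rw [phase, norm_mul, Complex.norm_exp_I_mul_ofReal, mul_one, Complex.norm_real, Real.norm_eq_abs]

theorem phase_zero (z : ℂ) : phase 0 z = z.re := by simp [phase]

theorem phase_mul_phase (s t : ℝ) (z : ℂ) : phase s z * phase t z = z.re * phase (s + t) z := by
  have h : Complex.exp (Complex.I * ((-(s + t) / z.re : ℝ) : ℂ)) =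
      Complex.exp (Complex.I * ((-s / z.re : ℝ) : ℂ)) *
        Complex.exp (Complex.I * ((-t / z.re : ℝ) : ℂ)) := by
    rw [← Complex.exp_add]
    congr 1
    push_cast
    ring
  rw [phase, phase, phase, h]
  ring

theorem star_phase (t : ℝ) (z : ℂ) : star (phase t z) = phase (-t) z := by
  change (starRingEnd ℂ) _ = _
  rw [phase, phase, map_mul, Complex.conj_ofReal, ← Complex.exp_conj, map_mul, Complex.conj_I,
    Complex.conj_ofReal]
  congr 2
  push_cast
  ring

/-- The exponential has no limit at `re z = 0` when `t ≠ 0`, but its modulus is one, so the factor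
`re z` forces the product to `0`. -/
theorem continuous_phase (t : ℝ) : Continuous (phase t) := by
  rw [continuous_iff_continuousAt]
  intro z
  by_cases hz : z.re = 0
  · have h0 : phase t z = 0 := by simp [phase, hz]
    rw [ContinuousAt, h0, tendsto_zero_iff_norm_tendsto_zero]
    simp_rw [norm_phase]
    have h := (continuous_abs.comp Complex.continuous_re).tendsto z
    simpa [hz, Function.comp_def] using h
  · refine (Complex.continuous_ofReal.comp Complex.continuous_re).continuousAt.mul ?_
    refine Complex.continuous_exp.continuousAt.comp ?_
    refine continuousAt_const.mul (Complex.continuous_ofReal.continuousAt.comp ?_)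
    exact continuousAt_const.div Complex.continuous_re.continuousAt hz

/-- The factor `re z` absorbs the `1 / re z` in `|exp (iθ) - 1| ≤ |θ|`, which makes the bound
uniform in `z`. -/
theorem norm_phase_sub_le (s t : ℝ) (z : ℂ) : ‖phase s z - phase t z‖ ≤ |s - t| := by
  by_cases hz : z.re = 0
  · simp [phase, hz]
  have h : phase s z - phase t z =
      phase t z * (Complex.exp (Complex.I * ((-(s - t) / z.re : ℝ) : ℂ)) - 1) := by
    rw [phase, phase, mul_sub, mul_one, mul_assoc, ← Complex.exp_add]
    congr 3
    push_cast
    ring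
  rw [h, norm_mul, norm_phase]
  refine (mul_le_mul_of_nonneg_left Real.norm_exp_I_mul_ofReal_sub_one_le (abs_nonneg _)).trans ?_
  rw [Real.norm_eq_abs, ← abs_mul, mul_div_cancel₀ _ hz, abs_neg]

theorem norm_exp_I_mul_sub_one_sub_le (θ : ℝ) :
    ‖Complex.exp (Complex.I * θ) - 1 - Complex.I * θ‖ ≤ 2 * θ ^ 2 := by
  have hn : ‖Complex.I * (θ : ℂ)‖ = |θ| := by simp
  rcases le_total |θ| 1 with h | h
  · have := Complex.norm_exp_sub_one_sub_id_le (x := Complex.I * θ) (by rwa [hn])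
    rw [hn, sq_abs] at this
    nlinarith [sq_nonneg θ]
  -- For `|θ| ≥ 1` the crude bound `2|θ|` is already at most `2θ²`.
  · have h1 := norm_sub_le (Complex.exp (Complex.I * θ) - 1) (Complex.I * θ)
    have h2 := Real.norm_exp_I_mul_ofReal_sub_one_le (x := θ)
    rw [hn] at h1
    rw [Real.norm_eq_abs] at h2
    rw [← sq_abs θ]
    nlinarith

/-- The quadratic remainder carries `t² / (re z)²`, so a second factor `re z` is needed for
uniformity; for operators, this restricts the estimate to vectors in the range of `R`. -/
theorem norm_phase_taylor_le (t : ℝ) (z : ℂ) :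
    ‖(phase t z - z.re) * z.re + Complex.I * t * z.re‖ ≤ 2 * t ^ 2 := by
  by_cases hz : z.re = 0
  · simp [phase, hz]
    positivity
  have h : (phase t z - z.re) * z.re + Complex.I * t * z.re =
      ((z.re ^ 2 : ℝ) : ℂ) * (Complex.exp (Complex.I * ((-t / z.re : ℝ) : ℂ)) - 1 -
        Complex.I * ((-t / z.re : ℝ) : ℂ)) := by
    have hz' : (z.re : ℂ) ≠ 0 := by exact_mod_cast hz
    rw [phase]
    push_cast
    field_simp
    ring
  rw [h, norm_mul, Complex.norm_real, Real.norm_of_nonneg (sq_nonneg _)]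
  refine (mul_le_mul_of_nonneg_left (norm_exp_I_mul_sub_one_sub_le _) (sq_nonneg _)).trans ?_
  rw [div_pow]
  field_simp
  simp

/-! ### Functional calculus for `R` and extension from its dense range -/

section Group

variable {E : Type*} [NormedAddCommGroup E] [InnerProductSpace ℂ E] [CompleteSpace E]

/-- The operator `R exp (-i t R⁻¹)`. -/
def regGroup (R : E →L[ℂ] E) (t : ℝ) : E →L[ℂ] E := cfc (phase t) R

variable {R : E →L[ℂ] E}

/-- The spectrum of `R` is real, so taking real parts changes nothing there. -/
theorem cfc_ofReal_re (hR : IsSelfAdjoint R) : cfc (fun z : ℂ => (z.re : ℂ)) R = R := by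
  have := hR.isStarNormal
  conv_rhs => rw [← cfc_id' ℂ R]
  refine cfc_congr fun z hz => ?_
  exact (hR.mem_spectrum_eq_re hz).symm

theorem regGroup_zero (hR : IsSelfAdjoint R) : regGroup R 0 = R := by
  conv_rhs => rw [← cfc_ofReal_re hR]
  exact cfc_congr fun z _ => phase_zero z

theorem continuous_re_ofReal : Continuous fun z : ℂ => (z.re : ℂ) :=
  Complex.continuous_ofReal.comp Complex.continuous_re

theorem regGroup_mul (hR : IsSelfAdjoint R) (s t : ℝ) :
    regGroup R s * regGroup R t = R * regGroup R (s + t) := by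
  have := hR.isStarNormal
  have h := cfc_mul _ _ R continuous_re_ofReal.continuousOn (continuous_phase (s + t)).continuousOn
  rw [cfc_ofReal_re hR] at h
  rw [regGroup, regGroup, regGroup, ← h,
    ← cfc_mul _ _ R (continuous_phase s).continuousOn (continuous_phase t).continuousOn]
  exact cfc_congr fun z _ => phase_mul_phase s t z

theorem regGroup_commute (hR : IsSelfAdjoint R) (t : ℝ) : R * regGroup R t = regGroup R t * R := by
  have h := cfc_commute_cfc (fun z : ℂ => (z.re : ℂ)) (phase t) R
  rwa [cfc_ofReal_re hR] at h

theorem star_regGroup (t : ℝ) : star (regGroup R t) = regGroup R (-t) := by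
  rw [regGroup, ← cfc_star]
  exact cfc_congr fun z _ => star_phase t z

theorem norm_regGroup_sub_le (hR : IsSelfAdjoint R) (s t : ℝ) :
    ‖regGroup R s - regGroup R t‖ ≤ |s - t| := by
  have := hR.isStarNormal
  rw [regGroup, regGroup,
    ← cfc_sub _ _ R (continuous_phase s).continuousOn (continuous_phase t).continuousOn]
  exact norm_cfc_le (abs_nonneg _) fun z _ => norm_phase_sub_le s t z

theorem norm_regGroup_taylor_le (hR : IsSelfAdjoint R) (t : ℝ) :
    ‖(regGroup R t - R) * R + (Complex.I * t) • R‖ ≤ 2 * t ^ 2 := by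
  have := hR.isStarNormal
  have h1 := continuous_phase t
  have h2 := continuous_re_ofReal
  have e : (regGroup R t - R) * R + (Complex.I * t) • R =
      cfc (fun z : ℂ => (phase t z - z.re) * z.re + Complex.I * t * z.re) R := by
    have h3 : Continuous fun z : ℂ => phase t z - z.re := h1.sub h2
    have h4 : Continuous fun z : ℂ => (phase t z - z.re) * z.re := h3.mul h2
    have h5 : Continuous fun z : ℂ => Complex.I * t * z.re := continuous_const.mul h2
    rw [cfc_add _ _ _ h4.continuousOn h5.continuousOn, cfc_mul _ _ R h3.continuousOn h2.continuousOn,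
      cfc_sub _ _ R h1.continuousOn h2.continuousOn,
      cfc_const_mul _ _ R h2.continuousOn, cfc_ofReal_re hR, regGroup]
  rw [e]
  exact norm_cfc_le (by positivity) fun z _ => norm_phase_taylor_le t z

/-- The product rule at `-t` and `t` gives `S* S = R²` for `S = regGroup R t`. -/
theorem norm_regGroup_apply (hR : IsSelfAdjoint R) (t : ℝ) (x : E) :
    ‖regGroup R t x‖ = ‖R x‖ := by
  have h1 : star (regGroup R t) * regGroup R t = star R * R := by
    rw [star_regGroup, regGroup_mul hR, neg_add_cancel, regGroup_zero hR, hR.star_eq]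
  have h2 : ∀ S : E →L[ℂ] E, ⟪(star S * S) x, x⟫_ℂ = (‖S x‖ : ℂ) ^ 2 := fun S => by
    rw [mul_apply_eq_comp, ContinuousLinearMap.star_eq_adjoint,
      ContinuousLinearMap.adjoint_inner_left, inner_self_eq_norm_sq_to_K]
    rfl
  have h3 := h2 (regGroup R t)
  rw [h1, h2 R] at h3
  have h4 : ‖R x‖ ^ 2 = ‖regGroup R t x‖ ^ 2 := by exact_mod_cast h3
  exact (sq_eq_sq₀ (norm_nonneg _) (norm_nonneg _)).1 h4.symm

/-- `(ran R)ᗮ = ker R* = ker R = 0`. -/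
theorem denseRange_of_injective (hR : IsSelfAdjoint R) (hi : Function.Injective R) :
    DenseRange R := by
  have h : (LinearMap.range R.toLinearMap)ᗮ = ⊥ := by
    rw [ContinuousLinearMap.orthogonal_range, ← ContinuousLinearMap.star_eq_adjoint, hR.star_eq]
    exact LinearMap.ker_eq_bot.2 hi
  have h2 := (Submodule.dense_iff_topologicalClosure_eq_top).2
    ((Submodule.topologicalClosure_eq_top_iff).2 h)
  exact h2

/-- The operator `exp (-i t R⁻¹)`. -/
def expGroup (R : E →L[ℂ] E) (t : ℝ) : E →L[ℂ] E :=
  LinearMap.extendOfNorm (regGroup R t).toLinearMap R.toLinearMap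

variable (hR : IsSelfAdjoint R) (hi : Function.Injective R)
include hR hi

theorem expGroup_apply (t : ℝ) (x : E) : expGroup R t (R x) = regGroup R t x :=
  LinearMap.extendOfNorm_eq (f := (regGroup R t).toLinearMap) (e := R.toLinearMap)
    (denseRange_of_injective hR hi)
    ⟨1, fun y => by rw [one_mul]; exact (norm_regGroup_apply hR t y).le⟩ x

theorem norm_expGroup_apply (t : ℝ) (x : E) : ‖expGroup R t x‖ = ‖x‖ := by
  refine (denseRange_of_injective hR hi).induction_on x ?_ fun y => ?_
  · exact isClosed_eq (expGroup R t).continuous.norm continuous_norm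
  · rw [expGroup_apply hR hi, norm_regGroup_apply hR]

theorem expGroup_comm (t : ℝ) (x : E) : expGroup R t (R x) = R (expGroup R t x) := by
  refine (denseRange_of_injective hR hi).induction_on x ?_ fun y => ?_
  · exact isClosed_eq ((expGroup R t).continuous.comp R.continuous)
      (R.continuous.comp (expGroup R t).continuous)
  · rw [expGroup_apply hR hi, expGroup_apply hR hi]
    exact (DFunLike.congr_fun (regGroup_commute hR t) y).symm

theorem expGroup_zero (x : E) : expGroup R 0 x = x := by
  refine (denseRange_of_injective hR hi).induction_on x ?_ fun y => ?_
  · exact isClosed_eq (expGroup R 0).continuous continuous_id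
  · rw [expGroup_apply hR hi, regGroup_zero hR]

theorem expGroup_add (s t : ℝ) (x : E) :
    expGroup R (s + t) x = expGroup R s (expGroup R t x) := by
  refine (denseRange_of_injective hR hi).induction_on x ?_ fun y => ?_
  · exact isClosed_eq (expGroup R (s + t)).continuous
      ((expGroup R s).continuous.comp (expGroup R t).continuous)
  -- The vector `regGroup R t y` is not visibly in the range of `R`; applying `R` to both sides
  -- reduces the claim to `regGroup_mul`.
  · apply hi
    rw [expGroup_apply hR hi (s + t), expGroup_apply hR hi t, ← expGroup_comm hR hi s,
      expGroup_apply hR hi s]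
    exact (DFunLike.congr_fun (regGroup_mul hR s t) y).symm

/-- Orbits of vectors `R y` are Lipschitz, and since the group is isometric, approximating `x` by `R
y` approximates its orbit uniformly in `t`. -/
theorem continuous_expGroup (x : E) : Continuous fun t => expGroup R t x := by
  refine continuous_of_uniform_approx_of_continuous fun u hu => ?_
  obtain ⟨ε, hε, hu⟩ := Metric.mem_uniformity_dist.1 hu
  obtain ⟨y, hy⟩ := (denseRange_of_injective hR hi).exists_dist_lt x hε
  refine ⟨fun t => expGroup R t (R y), ?_, fun t => hu ?_⟩
  · simp_rw [expGroup_apply hR hi]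
    refine (LipschitzWith.of_dist_le_mul (K := ‖y‖₊) fun s t => ?_).continuous
    rw [dist_eq_norm, ← sub_apply, Real.dist_eq, coe_nnnorm, mul_comm]
    exact ((regGroup R s - regGroup R t).le_opNorm y).trans
      (mul_le_mul_of_nonneg_right (norm_regGroup_sub_le hR s t) (norm_nonneg _))
  · rw [dist_eq_norm, ← map_sub, norm_expGroup_apply hR hi, ← dist_eq_norm]
    exact hy

/-- Formally, `x exp (-it/x)` has derivative `-i` at `t = 0`. The Taylor bound proves this on the
range of `R`; the Lipschitz bound, uniform in the vector, carries it to the closure. -/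
theorem hasDerivAt_regGroup (x : E) :
    HasDerivAt (fun t => regGroup R t x) (-(Complex.I • x)) 0 := by
  rw [hasDerivAt_iff_isLittleO_nhds_zero, Asymptotics.isLittleO_iff]
  intro c hc
  obtain ⟨w, hw⟩ := (denseRange_of_injective hR hi).exists_dist_lt x (show 0 < c / 4 by positivity)
  rw [dist_eq_norm] at hw
  -- This radius makes the Taylor remainder `2t²‖w‖` at most `|t| c / 2`; the two approximation
  -- errors take `|t| c / 4` each.
  have hδ : 0 < c / (4 * (‖w‖ + 1)) := by positivity
  filter_upwards [Metric.ball_mem_nhds (0 : ℝ) hδ] with t ht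
  rw [Metric.mem_ball, dist_zero_right, Real.norm_eq_abs, lt_div_iff₀ (by positivity)] at ht
  rw [zero_add, regGroup_zero hR, Real.norm_eq_abs]
  have e : regGroup R t x - R x - t • -(Complex.I • x) =
      (regGroup R t - R) (x - R w) + (Complex.I * t) • (x - R w) +
        ((regGroup R t - R) * R + (Complex.I * t) • R) w := by
    simp only [sub_apply, add_apply,
      mul_apply_eq_comp, smul_apply, map_sub, smul_sub, smul_neg,
      mul_comm Complex.I, mul_smul, Complex.coe_smul]
    abel
  have h1 : ‖(regGroup R t - R) (x - R w)‖ ≤ |t| * (c / 4) := by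
    refine ((regGroup R t - R).le_opNorm _).trans ?_
    have := norm_regGroup_sub_le hR t 0
    rw [regGroup_zero hR, sub_zero] at this
    exact mul_le_mul this hw.le (norm_nonneg _) (abs_nonneg _)
  have h2 : ‖(Complex.I * t) • (x - R w)‖ ≤ |t| * (c / 4) := by
    rw [norm_smul, norm_mul, Complex.norm_I, one_mul, Complex.norm_real, Real.norm_eq_abs]
    exact mul_le_mul_of_nonneg_left hw.le (abs_nonneg _)
  have h3 : ‖((regGroup R t - R) * R + (Complex.I * t) • R) w‖ ≤ |t| * (c / 2) := by
    refine (ContinuousLinearMap.le_opNorm _ _).trans ?_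
    refine (mul_le_mul_of_nonneg_right (norm_regGroup_taylor_le hR t) (norm_nonneg _)).trans ?_
    rw [← sq_abs]
    nlinarith [abs_nonneg t, norm_nonneg w]
  rw [e]
  refine (norm_add₃_le).trans ?_
  linarith

/-- The operator `-i R⁻¹` generates the unitary group `exp (-i t R⁻¹)`. -/
theorem generatesUnitaryGroup_of_inverse {T : E →ₗ.[ℂ] E}
    (hT : ∀ x y, (x, y) ∈ T.graph ↔ x = R (Complex.I • y)) : GeneratesUnitaryGroup T := by
  have inv : ∀ t x, expGroup R t (expGroup R (-t) x) = x := fun t x => by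
    rw [← expGroup_add hR hi, add_neg_cancel, expGroup_zero hR hi]
  let V : ℝ → (E ≃ₗᵢ[ℂ] E) := fun t =>
    { toLinearEquiv := LinearEquiv.ofLinearMap (expGroup R t).toLinearMap
        (expGroup R (-t)).toLinearMap (LinearMap.ext fun x => inv t x)
        (LinearMap.ext fun x => by simpa using inv (-t) x)
      norm_map' := norm_expGroup_apply hR hi t }
  have hV : ∀ t x, V t x = expGroup R t x := fun _ _ => rfl
  refine ⟨V, ?_, fun s t => ?_, fun x => continuous_expGroup hR hi x, fun x y => ?_⟩
  · ext x
    exact expGroup_zero hR hi x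
  · ext x
    exact expGroup_add hR hi s t x
  · simp_rw [hV, hT]
    constructor
    · rintro rfl
      simp_rw [expGroup_apply hR hi]
      simpa [smul_smul] using hasDerivAt_regGroup hR hi (Complex.I • y)
    · intro h
      -- Applying `R` to the differentiable orbit of `x` yields `regGroup R t x`, whose derivative
      -- is known; uniqueness gives `R y = -i x`.
      have h1 := R.hasFDerivAt.restrictScalars ℝ |>.comp_hasDerivAt (0 : ℝ) h
      have h2 : HasDerivAt (fun t => regGroup R t x) (R y) 0 := by
        refine h1.congr_of_eventuallyEq (Filter.Eventually.of_forall fun t => ?_)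
        change _ = R (expGroup R t x)
        rw [← expGroup_comm hR hi, expGroup_apply hR hi]
      rw [map_smul, h2.unique (hasDerivAt_regGroup hR hi x), smul_neg, smul_smul, Complex.I_mul_I]
      simp

/-- The graph of `T` consists of the pairs `(R b, b)`. Testing the adjoint relation on them gives
`⟪b, x⟫ = ⟪R b, y⟫ = ⟪b, R y⟫` for every `b`, that is, `x = R y`. -/
theorem isSelfAdjoint_of_inverse {T : E →ₗ.[ℂ] E}
    (hT : ∀ x y, (x, y) ∈ T.graph ↔ x = R y) : IsSelfAdjoint T := by
  have hd : Dense (T.domain : Set E) := by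
    refine (denseRange_of_injective hR hi).mono ?_
    rintro _ ⟨y, rfl⟩
    exact LinearPMap.mem_domain_of_mem_graph ((hT _ y).2 rfl)
  rw [LinearPMap.isSelfAdjoint_def]
  refine LinearPMap.eq_of_eq_graph ?_
  ext ⟨x, y⟩
  rw [LinearPMap.adjoint_graph_eq_graph_adjoint hd, Submodule.mem_adjoint_iff, hT]
  have hs : ∀ b, ⟪R b, y⟫_ℂ = ⟪b, R y⟫_ℂ := fun b => hR.isSymmetric b y
  constructor
  · intro h
    refine ext_inner_left ℂ fun b => ?_
    have := h (R b) b ((hT _ _).2 rfl)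
    rw [← hs b]
    exact sub_eq_zero.1 this
  · rintro rfl a b hab
    rw [(hT _ _).1 hab, hs, sub_self]

end Group

/-! ### Graphs of unbounded operators -/

section Graphs

variable {E F G : Type*}
variable [AddCommGroup E] [Module ℂ E] [AddCommGroup F] [Module ℂ F] [AddCommGroup G] [Module ℂ G]

/-- Working with graphs turns operator equalities, domains included, into equivalences free of
domain proofs. -/
theorem mem_graph_opComp {S : F →ₗ.[ℂ] G} {T : E →ₗ.[ℂ] F} {x : E} {z : G} :
    (x, z) ∈ (opComp S T).graph ↔ ∃ y, (x, y) ∈ T.graph ∧ (y, z) ∈ S.graph := by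
  constructor
  · intro h
    obtain ⟨u, rfl, rfl⟩ := (LinearPMap.mem_graph_iff _).1 h
    exact ⟨_, T.mem_graph ⟨u, u.2.1⟩, S.mem_graph ⟨_, u.2.2⟩⟩
  · rintro ⟨y, h1, h2⟩
    obtain ⟨u, rfl, rfl⟩ := (LinearPMap.mem_graph_iff _).1 h1
    obtain ⟨v, hv, rfl⟩ := (LinearPMap.mem_graph_iff _).1 h2
    have hu : T u ∈ S.domain := by
      rw [← show (v : F) = T u from hv]
      exact v.2
    obtain rfl : v = ⟨T u, hu⟩ := Subtype.ext hv
    exact (opComp S T).mem_graph ⟨u, u.2, hu⟩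

theorem mem_graph_everywhere {T : E →ₗ[ℂ] F} {x : E} {y : F} :
    (x, y) ∈ (everywhere T).graph ↔ y = T x := by
  constructor
  · intro h
    obtain ⟨u, rfl, rfl⟩ := (LinearPMap.mem_graph_iff _).1 h
    rfl
  · rintro rfl
    exact (everywhere T).mem_graph ⟨x, Submodule.mem_top⟩

theorem mem_graph_opComp_everywhere {S : F →ₗ.[ℂ] G} {T : E →ₗ[ℂ] F} {x : E} {z : G} :
    (x, z) ∈ (opComp S (everywhere T)).graph ↔ (T x, z) ∈ S.graph := by
  simp_rw [mem_graph_opComp, mem_graph_everywhere]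
  exact ⟨fun ⟨y, hy, h⟩ => hy ▸ h, fun h => ⟨_, rfl, h⟩⟩

theorem mem_graph_everywhere_opComp {S : F →ₗ[ℂ] G} {T : E →ₗ.[ℂ] F} {x : E} {z : G} :
    (x, z) ∈ (opComp (everywhere S) T).graph ↔ ∃ y, (x, y) ∈ T.graph ∧ z = S y := by
  simp_rw [mem_graph_opComp, mem_graph_everywhere]

theorem mem_graph_smul {T : E →ₗ.[ℂ] F} {c : ℂ} (hc : c ≠ 0) {x : E} {y : F} :
    (x, y) ∈ (c • T).graph ↔ (x, c⁻¹ • y) ∈ T.graph := by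
  constructor
  · intro h
    obtain ⟨u, rfl, rfl⟩ := (LinearPMap.mem_graph_iff _).1 h
    have e : c⁻¹ • (c • T) u = T u := by
      rw [LinearPMap.smul_apply, smul_smul, inv_mul_cancel₀ hc, one_smul]
    exact (LinearPMap.mem_graph_iff _).2 ⟨u, rfl, e.symm⟩
  · intro h
    obtain ⟨u, rfl, hu⟩ := (LinearPMap.mem_graph_iff _).1 h
    refine (LinearPMap.mem_graph_iff _).2 ⟨u, rfl, ?_⟩
    rw [LinearPMap.smul_apply, hu, smul_smul, mul_inv_cancel₀ hc, one_smul]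

theorem mem_graph_neg {T : E →ₗ.[ℂ] F} {x : E} {y : F} :
    (x, y) ∈ (-T).graph ↔ (x, -y) ∈ T.graph := by
  constructor
  · intro h
    obtain ⟨u, rfl, rfl⟩ := (LinearPMap.mem_graph_iff _).1 h
    exact (LinearPMap.mem_graph_iff _).2 ⟨u, rfl, (neg_neg _).symm⟩
  · intro h
    obtain ⟨u, rfl, hu⟩ := (LinearPMap.mem_graph_iff _).1 h
    exact (LinearPMap.mem_graph_iff _).2 ⟨u, rfl, neg_eq_iff_eq_neg.2 hu⟩

end Graphs

/-! ### Graphs of block operators and of adjoints -/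

section Hilbert

variable {E F E' F' : Type*}
variable [NormedAddCommGroup E] [InnerProductSpace ℂ E]
variable [NormedAddCommGroup F] [InnerProductSpace ℂ F]
variable [NormedAddCommGroup E'] [InnerProductSpace ℂ E']
variable [NormedAddCommGroup F'] [InnerProductSpace ℂ F']

theorem mem_graph_offDiag {B : F →ₗ.[ℂ] E'} {C : E →ₗ.[ℂ] F'} {x : WithLp 2 (E × F)}
    {y : WithLp 2 (E' × F')} :
    (x, y) ∈ (offDiag B C).graph ↔ (x.snd, y.fst) ∈ B.graph ∧ (x.fst, y.snd) ∈ C.graph := by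
  constructor
  · intro h
    obtain ⟨u, rfl, rfl⟩ := (LinearPMap.mem_graph_iff _).1 h
    exact ⟨B.mem_graph ⟨_, u.2.2⟩, C.mem_graph ⟨_, u.2.1⟩⟩
  · rintro ⟨h1, h2⟩
    obtain ⟨u, hu, hu'⟩ := (LinearPMap.mem_graph_iff _).1 h1
    obtain ⟨v, hv, hv'⟩ := (LinearPMap.mem_graph_iff _).1 h2
    dsimp only at hu hu' hv hv'
    have hx : x ∈ (offDiag B C).domain := ⟨hv ▸ v.2, hu ▸ u.2⟩
    refine (LinearPMap.mem_graph_iff _).2 ⟨⟨x, hx⟩, rfl, WithLp.ofLp_injective 2 (Prod.ext ?_ ?_)⟩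
    · refine Eq.trans ?_ hu'
      exact congrArg B (Subtype.ext hu.symm)
    · refine Eq.trans ?_ hv'
      exact congrArg C (Subtype.ext hv.symm)

theorem mem_graph_adjoint_iff [CompleteSpace E] {T : E →ₗ.[ℂ] F} (hT : Dense (T.domain : Set E))
    {x : F} {y : E} :
    (x, y) ∈ T.adjoint.graph ↔ ∀ f : T.domain, ⟪T f, x⟫_ℂ = ⟪(f : E), y⟫_ℂ := by
  rw [LinearPMap.adjoint_graph_eq_graph_adjoint hT, Submodule.mem_adjoint_iff]
  constructor
  · exact fun h f => sub_eq_zero.1 (h _ _ (T.mem_graph f))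
  · intro h a b hab
    obtain ⟨u, rfl, rfl⟩ := (LinearPMap.mem_graph_iff _).1 hab
    exact sub_eq_zero.2 (h u)

end Hilbert

variable {H₁ H₂ : Type*}
variable [NormedAddCommGroup H₁] [InnerProductSpace ℂ H₁] [CompleteSpace H₁]
variable [NormedAddCommGroup H₂] [InnerProductSpace ℂ H₂] [CompleteSpace H₂]
variable {A : H₁ →ₗ.[ℂ] H₂} (hA : WaveHypothesis A)

/-! ### The inverse of `i G_{A,0}` -/

/-- The bounded embedding `f ↦ f` of `H_A` into `H₁`. -/
def energyEmbedding : EnergySpace hA →L[ℂ] H₁ :=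
  LinearMap.mkContinuousOfExistsBound (A.domain.subtype : EnergySpace hA →ₗ[ℂ] H₁) (by
    obtain ⟨ε, hε, h⟩ := hA.lower_bound
    refine ⟨Real.sqrt ε⁻¹, fun f => le_of_sq_le_sq ?_ (by positivity)⟩
    rw [mul_pow, Real.sq_sqrt (by positivity), inv_mul_eq_div, le_div_iff₀ hε, mul_comm]
    exact h f)

/-- Membership in the graph of `A*` says `(g, f)_A = ⟪J g, v⟫` for all `g ∈ H_A`, which is the
defining property of `J* v`. -/
theorem mem_graph_adjoint_toH₂_iff {f : EnergySpace hA} {v : H₁} :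
    (EnergySpace.toH₂ hA f, v) ∈ A.adjoint.graph ↔
      f = ContinuousLinearMap.adjoint (energyEmbedding hA) v := by
  rw [mem_graph_adjoint_iff hA.dense_domain]
  constructor
  · intro h
    refine ext_inner_left ℂ fun g => ?_
    rw [ContinuousLinearMap.adjoint_inner_right]
    exact h g
  · rintro rfl g
    exact ContinuousLinearMap.adjoint_inner_right (energyEmbedding hA) g v

theorem mem_graph_opJ {u : H₁} {f : EnergySpace hA} :
    (u, f) ∈ (opJ hA).graph ↔ u = energyEmbedding hA f := by
  constructor
  · intro h
    obtain ⟨v, rfl, rfl⟩ := (LinearPMap.mem_graph_iff _).1 h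
    rfl
  · rintro rfl
    exact (opJ hA).mem_graph f

theorem mem_graph_opG {x y : WithLp 2 (EnergySpace hA × H₁)} :
    (x, y) ∈ (opG hA).graph ↔ x.snd = energyEmbedding hA y.fst ∧
      (EnergySpace.toH₂ hA x.fst, -y.snd) ∈ A.adjoint.graph := by
  rw [opG, mem_graph_offDiag, mem_graph_opJ, mem_graph_neg, mem_graph_opComp_everywhere]

/-- The inverse `(u, v) ↦ (i J* v, -i J u)` of `i G_{A,0}`, where `J` is the embedding of `H_A`
into `H₁`. -/
def inverseG : WithLp 2 (EnergySpace hA × H₁) →L[ℂ] WithLp 2 (EnergySpace hA × H₁) :=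
  (WithLp.prodContinuousLinearEquiv 2 ℂ (EnergySpace hA) H₁).symm.toContinuousLinearMap ∘L
    ((Complex.I • ContinuousLinearMap.adjoint (energyEmbedding hA) ∘L
        ContinuousLinearMap.snd ℂ (EnergySpace hA) H₁).prod
      (-Complex.I • energyEmbedding hA ∘L ContinuousLinearMap.fst ℂ (EnergySpace hA) H₁)) ∘L
    (WithLp.prodContinuousLinearEquiv 2 ℂ (EnergySpace hA) H₁).toContinuousLinearMap

theorem inverseG_apply (x : WithLp 2 (EnergySpace hA × H₁)) :
    inverseG hA x = WithLp.toLp 2 (Complex.I • ContinuousLinearMap.adjoint (energyEmbedding hA) x.snd,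
      -Complex.I • energyEmbedding hA x.fst) := rfl

theorem inverseG_isSelfAdjoint : IsSelfAdjoint (inverseG hA) := by
  rw [ContinuousLinearMap.isSelfAdjoint_iff_isSymmetric]
  intro x y
  change ⟪inverseG hA x, y⟫_ℂ = ⟪x, inverseG hA y⟫_ℂ
  rw [inverseG_apply, inverseG_apply, WithLp.prod_inner_apply, WithLp.prod_inner_apply]
  simp only [inner_smul_left, inner_smul_right, ContinuousLinearMap.adjoint_inner_left,
    ContinuousLinearMap.adjoint_inner_right, WithLp.ofLp_fst, WithLp.ofLp_snd]
  simp
  ring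

theorem mem_graph_opG_iff_inverseG {x y : WithLp 2 (EnergySpace hA × H₁)} :
    (x, y) ∈ (opG hA).graph ↔ x = inverseG hA (Complex.I • y) := by
  rw [mem_graph_opG, mem_graph_adjoint_toH₂_iff]
  have e : inverseG hA (Complex.I • y) =
      WithLp.toLp 2 (-ContinuousLinearMap.adjoint (energyEmbedding hA) y.snd,
        energyEmbedding hA y.fst) := by
    rw [inverseG_apply]
    refine WithLp.ofLp_injective 2 (Prod.ext ?_ ?_)
    · change Complex.I • ContinuousLinearMap.adjoint (energyEmbedding hA) (Complex.I • y.snd) = _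
      rw [map_smul, smul_smul, Complex.I_mul_I, neg_one_smul]
    · change -Complex.I • energyEmbedding hA (Complex.I • y.fst) = _
      rw [map_smul, smul_smul, neg_mul, Complex.I_mul_I, neg_neg, one_smul]
  rw [e, map_neg]
  constructor
  · rintro ⟨h1, h2⟩
    exact WithLp.ofLp_injective 2 (Prod.ext h2 h1)
  · rintro rfl
    exact ⟨rfl, rfl⟩

theorem mem_graph_I_smul_opG_iff {x y : WithLp 2 (EnergySpace hA × H₁)} :
    (x, y) ∈ (Complex.I • opG hA).graph ↔ x = inverseG hA y := by
  rw [mem_graph_smul Complex.I_ne_zero, mem_graph_opG_iff_inverseG, smul_smul,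
    mul_inv_cancel₀ Complex.I_ne_zero, one_smul]

/-- If `inverseG hA y = 0`, then `(0, y)` lies in the graph of the operator `iG`, which is
single-valued. -/
theorem inverseG_injective : Function.Injective (inverseG hA) := by
  refine (injective_iff_map_eq_zero _).2 fun y hy => ?_
  exact (Complex.I • opG hA).graph_fst_eq_zero_snd ((mem_graph_I_smul_opG_iff hA).2 rfl) hy

/-! ### Self-adjointness, the unitary group and the reflection -/

theorem isSelfAdjoint_I_smul_opG : IsSelfAdjoint (Complex.I • opG hA) :=
  isSelfAdjoint_of_inverse (inverseG_isSelfAdjoint hA) (inverseG_injective hA)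
    fun _ _ => mem_graph_I_smul_opG_iff hA

theorem generatesUnitaryGroup_opG : GeneratesUnitaryGroup (opG hA) :=
  generatesUnitaryGroup_of_inverse (inverseG_isSelfAdjoint hA) (inverseG_injective hA)
    fun _ _ => mem_graph_opG_iff_inverseG hA

/-- The unitary reflection `(f, g) ↦ (f, -g)` of `H_A ⊕ H₁`. -/
def velocityReflection :
    WithLp 2 (EnergySpace hA × H₁) ≃ₗᵢ[ℂ] WithLp 2 (EnergySpace hA × H₁) where
  toFun x := WithLp.toLp 2 (x.fst, -x.snd)
  invFun x := WithLp.toLp 2 (x.fst, -x.snd)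
  map_add' x y := WithLp.ofLp_injective 2 (Prod.ext rfl (neg_add x.snd y.snd))
  map_smul' c x := WithLp.ofLp_injective 2 (Prod.ext rfl (smul_neg c x.snd).symm)
  left_inv x := WithLp.ofLp_injective 2 (Prod.ext rfl (neg_neg x.snd))
  right_inv x := WithLp.ofLp_injective 2 (Prod.ext rfl (neg_neg x.snd))
  norm_map' x := by
    rw [WithLp.prod_norm_eq_of_L2, WithLp.prod_norm_eq_of_L2]
    change Real.sqrt (‖x.fst‖ ^ 2 + ‖-x.snd‖ ^ 2) = _
    rw [norm_neg]

/-- Since `G` is off-diagonal, conjugation by a sign change in one component reverses the sign of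
both blocks. -/
theorem unitarilyEquivalent_opG_neg : UnitarilyEquivalent (opG hA) (-opG hA) := by
  refine ⟨velocityReflection hA, LinearPMap.eq_of_eq_graph ?_⟩
  ext ⟨x, z⟩
  simp_rw [mem_graph_neg, mem_graph_everywhere_opComp, mem_graph_opComp_everywhere, mem_graph_opG]
  constructor
  · rintro ⟨h1, h2⟩
    refine ⟨WithLp.toLp 2 (z.fst, -z.snd), ⟨?_, ?_⟩,
      WithLp.ofLp_injective 2 (Prod.ext rfl (neg_neg z.snd).symm)⟩
    · change -x.snd = energyEmbedding hA z.fst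
      rw [h1]
      change -(energyEmbedding hA (-z.fst)) = _
      rw [map_neg, neg_neg]
    · exact h2
  · rintro ⟨y, ⟨h1, h2⟩, rfl⟩
    constructor
    · change x.snd = energyEmbedding hA (-y.fst)
      rw [map_neg, ← show -x.snd = energyEmbedding hA y.fst from h1, neg_neg]
    · change (_, - -(-y.snd)) ∈ _
      rw [neg_neg]
      exact h2

/-! ### Comparison with `Q_{A,0}` -/

omit [CompleteSpace H₂] in
theorem mem_graph_opQ {x y : WithLp 2 (H₁ × H₂)} :
    (x, y) ∈ (opQ A).graph ↔ (x.snd, y.fst) ∈ A.adjoint.graph ∧ (x.fst, y.snd) ∈ A.graph :=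
  mem_graph_offDiag

/-- Both sides are `0 ⊕ (ran A)ᗮ`: `A` is injective and `ker A* = (ran A)ᗮ`. -/
theorem orthogonal_range_inclusion : (LinearMap.range (inclusion hA).toLinearMap)ᗮ = kerQ hA := by
  ext x
  rw [kerQ, mem_opKer, mem_graph_opQ, mem_graph_adjoint_iff hA.dense_domain,
    Submodule.mem_orthogonal]
  constructor
  · intro h
    have h0 : x.fst = 0 := by
      have h1 := h _ ⟨WithLp.toLp 2 (x.fst, 0), rfl⟩
      change ⟪x.fst, x.fst⟫_ℂ + ⟪(0 : H₂), x.snd⟫_ℂ = 0 at h1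
      rwa [inner_zero_left, add_zero, inner_self_eq_zero] at h1
    refine ⟨fun f => ?_, ?_⟩
    · have h1 := h _ ⟨WithLp.toLp 2 (0, ⟨A f, f, rfl⟩), rfl⟩
      change ⟪(0 : H₁), x.fst⟫_ℂ + ⟪A f, x.snd⟫_ℂ = 0 at h1
      rw [inner_zero_left, zero_add] at h1
      exact h1.trans (inner_zero_right _).symm
    · rw [h0]
      exact A.graph.zero_mem
  · rintro ⟨h1, h2⟩ _ ⟨⟨u, ⟨_, f, rfl⟩⟩, rfl⟩
    obtain ⟨g, hg, hg'⟩ := (LinearPMap.mem_graph_iff _).1 h2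
    have h0 : g = 0 := hA.injective (hg'.trans A.map_zero.symm)
    have h3 : x.fst = 0 := by
      rw [← show (g : H₁) = x.fst from hg, h0]
      rfl
    change ⟪u, x.fst⟫_ℂ + ⟪A f, x.snd⟫_ℂ = 0
    rw [h3, inner_zero_right, zero_add]
    exact (h1 f).trans (inner_zero_right _)

/-- The range is closed, being an isometric image of a complete space, so it equals its double
complement. -/
theorem range_inclusion : LinearMap.range (inclusion hA).toLinearMap = (kerQ hA)ᗮ := by
  have hc : IsClosed (LinearMap.range (inclusion hA).toLinearMap : Set (WithLp 2 (H₁ × H₂))) :=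
    (inclusion hA).isometry.isClosedEmbedding.isClosed_range
  have := hc.completeSpace_coe
  rw [← orthogonal_range_inclusion, Submodule.orthogonal_orthogonal]

theorem inclusion_adjoint_inclusion (y : WithLp 2 (H₁ × rangeSpace hA)) :
    ContinuousLinearMap.adjoint (inclusion hA).toContinuousLinearMap (inclusion hA y) = y := by
  refine ext_inner_left ℂ fun z => ?_
  rw [ContinuousLinearMap.adjoint_inner_right]
  exact (inclusion hA).inner_map_map z y

/-- For an isometry `V`, `V V*` is the orthogonal projection onto `ran V`, here `(ker Q)ᗮ`. -/
theorem id_sub_starProjection_kerQ (x : WithLp 2 (H₁ × H₂)) :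
    (ContinuousLinearMap.id ℂ (WithLp 2 (H₁ × H₂)) - (kerQ hA).starProjection) x =
      inclusion hA (ContinuousLinearMap.adjoint (inclusion hA).toContinuousLinearMap x) := by
  set y := ContinuousLinearMap.adjoint (inclusion hA).toContinuousLinearMap x with hy
  have h : (kerQ hA).starProjection x = x - inclusion hA y := by
    refine Submodule.eq_starProjection_of_mem_of_inner_eq_zero ?_ fun w hw => ?_
    · rw [← orthogonal_range_inclusion, Submodule.mem_orthogonal]
      rintro _ ⟨z, rfl⟩
      change ⟪inclusion hA z, _⟫_ℂ = 0
      rw [inner_sub_right, LinearIsometry.inner_map_map, hy,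
        ContinuousLinearMap.adjoint_inner_right]
      exact sub_self _
    · rw [sub_sub_cancel]
      rw [← orthogonal_range_inclusion] at hw
      exact hw _ ⟨y, rfl⟩
  rw [sub_apply, h]
  exact sub_sub_cancel _ _

theorem mem_graph_opQred {x z : WithLp 2 (H₁ × H₂)} :
    (x, z) ∈ (opQred hA).graph ↔
      (inclusion hA (ContinuousLinearMap.adjoint (inclusion hA).toContinuousLinearMap x), z) ∈
        (opQ A).graph := by
  rw [opQred, mem_graph_opComp_everywhere, ContinuousLinearMap.coe_coe, id_sub_starProjection_kerQ]

theorem mem_graph_conjG {y w : WithLp 2 (H₁ × rangeSpace hA)} :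
    (y, w) ∈ (conjG hA).graph ↔ (inclusion hA y, inclusion hA w) ∈ (opQ A).graph := by
  -- The factor `i` in `U⁻¹` cancels against the `i` multiplying `G`, leaving the relation for `A*`
  -- unchanged.
  have hsmul : ∀ {a : H₂} {b : H₁}, (Complex.I • a, -(Complex.I⁻¹ • b)) ∈ A.adjoint.graph ↔
      (a, b) ∈ A.adjoint.graph := fun {a b} => by
    rw [Complex.inv_I, neg_smul, neg_neg]
    exact A.adjoint.graph.smul_mem_iff Complex.I_ne_zero (x := (a, b))
  have hfst : EnergySpace.toH₂ hA ((unitaryU hA).symm y).fst = Complex.I • (y.snd : H₂) := by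
    change EnergySpace.toH₂ hA (Complex.I • (tildeA hA).symm y.snd) = _
    rw [map_smul]
    exact congrArg (fun v : rangeSpace hA => Complex.I • (v : H₂))
      ((tildeA hA).apply_symm_apply y.snd)
  have hG : ∀ q, ((unitaryU hA).symm y, q) ∈ (Complex.I • opG hA).graph ↔
      y.fst = energyEmbedding hA (-Complex.I • q.fst) ∧
        ((y.snd : H₂), q.snd) ∈ A.adjoint.graph := fun q => by
    rw [mem_graph_smul Complex.I_ne_zero, mem_graph_opG, hfst]
    refine and_congr ?_ hsmul
    rw [Complex.inv_I]
    rfl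
  rw [conjG, mem_graph_everywhere_opComp, mem_graph_opQ]
  simp_rw [mem_graph_opComp_everywhere]
  constructor
  · rintro ⟨q, hq, rfl⟩
    obtain ⟨h1, h2⟩ := (hG q).1 hq
    refine ⟨h2, ?_⟩
    -- The element `-i q.fst` of `dom A` is `y.fst`, and `A` maps it to the second component of `U
    -- q`.
    refine (LinearPMap.mem_graph_iff _).2 ⟨(-Complex.I • q.fst : EnergySpace hA), h1.symm, ?_⟩
    exact (EnergySpace.toH₂ hA).map_smul (-Complex.I) q.fst
  · rintro ⟨h1, h2⟩
    refine ⟨(unitaryU hA).symm w, (hG _).2 ⟨?_, h1⟩, ((unitaryU hA).apply_symm_apply w).symm⟩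
    obtain ⟨g, hg, hg'⟩ := (LinearPMap.mem_graph_iff _).1 h2
    have e : (tildeA hA).symm w.snd = (g : EnergySpace hA) :=
      (LinearIsometryEquiv.symm_apply_eq _).2 (Subtype.ext hg'.symm)
    change _ = energyEmbedding hA (-Complex.I • Complex.I • (tildeA hA).symm w.snd)
    rw [smul_smul, neg_mul, Complex.I_mul_I, neg_neg, one_smul, e]
    exact hg.symm

-- The second component of a value of `Q` lies in `ran A`, so the value can be lifted to `H₁ ⊕ K_A`.
omit [CompleteSpace H₂] in
theorem exists_inclusion_of_mem_graph_opQ {x z : WithLp 2 (H₁ × H₂)} (h : (x, z) ∈ (opQ A).graph) :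
    ∃ w, z = inclusion hA w := by
  obtain ⟨f, -, hf⟩ := (LinearPMap.mem_graph_iff _).1 (mem_graph_opQ.1 h).2
  exact ⟨WithLp.toLp 2 (z.fst, ⟨z.snd, f, hf⟩), rfl⟩

theorem opQred_eq :
    opQred hA = opComp (everywhere (inclusion hA).toLinearMap)
      (opComp (conjG hA) (everywhere
        (ContinuousLinearMap.adjoint (inclusion hA).toContinuousLinearMap).toLinearMap)) := by
  refine LinearPMap.eq_of_eq_graph ?_
  ext ⟨x, z⟩
  simp_rw [mem_graph_everywhere_opComp, mem_graph_opComp_everywhere, mem_graph_opQred,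
    mem_graph_conjG]
  constructor
  · intro h
    obtain ⟨w, rfl⟩ := exists_inclusion_of_mem_graph_opQ hA h
    exact ⟨w, h, rfl⟩
  · rintro ⟨w, h, rfl⟩
    exact h

theorem opQred_comp_inclusion :
    opComp (opQred hA) (everywhere (inclusion hA).toLinearMap) =
      opComp (everywhere (inclusion hA).toLinearMap) (conjG hA) := by
  refine LinearPMap.eq_of_eq_graph ?_
  ext ⟨y, z⟩
  rw [mem_graph_opComp_everywhere, mem_graph_everywhere_opComp, mem_graph_opQred]
  simp_rw [mem_graph_conjG, LinearIsometry.coe_toLinearMap, inclusion_adjoint_inclusion]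
  constructor
  · intro h
    obtain ⟨w, rfl⟩ := exists_inclusion_of_mem_graph_opQ hA h
    exact ⟨w, h, rfl⟩
  · rintro ⟨w, h, rfl⟩
    exact h

end AbstractWave

end

open AbstractWave in
theorem theorem2p8 {H₁ H₂ : Type*}
    [NormedAddCommGroup H₁] [InnerProductSpace ℂ H₁] [CompleteSpace H₁]
    [TopologicalSpace.SeparableSpace H₁]
    [NormedAddCommGroup H₂] [InnerProductSpace ℂ H₂] [CompleteSpace H₂]
    [TopologicalSpace.SeparableSpace H₂]
    (A : H₁ →ₗ.[ℂ] H₂) (hA : WaveHypothesis A) :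
    -- `H₁ ⊕ K_A` is the orthogonal complement of `ker Q`
    LinearMap.range (inclusion hA).toLinearMap = (kerQ hA)ᗮ ∧
    -- on `H₁ ⊕ K_A`, the operators `Q [I - P_{ker Q}]` and `U i G U⁻¹` have the same domain and
    -- the same values
    opComp (opQred hA) (everywhere (inclusion hA).toLinearMap) =
      opComp (everywhere (inclusion hA).toLinearMap) (conjG hA) ∧
    -- in all of `H₁ ⊕ H₂`, `Q [I - P_{ker Q}]` is `U i G U⁻¹` extended by zero
    -- to the orthogonal complement of `H₁ ⊕ K_A`
    opQred hA =
      opComp (everywhere (inclusion hA).toLinearMap)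
        (opComp (conjG hA) (everywhere
          (ContinuousLinearMap.adjoint (inclusion hA).toContinuousLinearMap).toLinearMap)) ∧
    IsSelfAdjoint (Complex.I • opG hA) ∧
    GeneratesUnitaryGroup (opG hA) ∧
    UnitarilyEquivalent (opG hA) (-opG hA) :=
  ⟨range_inclusion hA, opQred_comp_inclusion hA, opQred_eq hA, isSelfAdjoint_I_smul_opG hA,
    generatesUnitaryGroup_opG hA, unitarilyEquivalent_opG_neg hA⟩
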